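/- **Theorem (Information-theoretic Bayesian bIC + ex post psIC $\Longrightarrow$ small revenue).** *Model.* Fix $k\in\mathbb{N}$ and a value domain $\mathbb{U}\subseteq\mathbb{R}_{\ge 0}$. A platform-assisted auction $\Pi$ of $k$ identical items is a protocol between a platform, a seller and any finite set of unit-demand buyers, each of whom knows its own identity and its own value in $\mathbb{U}$. The protocol runs for finitely many synchronous rounds (their number may depend on the set of participating identities). In each round every buyer and the seller may send a private message to the platform, the platform may send a private message to each of them, and everybody may post a message on a broadcast channel. Messages are chosen by private discrete randomization, depending on the sender's input and view (everything it has sent and received so far). At the end the platform sends $\bot$ (reject), or sends each buyer $i$ a private outcome $(x_i,p_i)$ (number of items $x_i\in\mathbb{N}$, payment $p_i\ge 0$) and the seller a private outcome $(t,\mu_S)$ (number of items sold, revenue $\mu_S\ge0$); buyers and the seller then accept or reject. The following hold with probability $1$. If everybody is honest, everybody accepts. If the platform is honest, all honest parties agree on whether to accept. An honest buyer of value $v_i$ who accepts has $x_i\in\{0,1\}$ and $x_iv_i-p_i\ge 0$. If the platform is honest and accepts, then $t=\sum_i x_i\le k$ and $\mu_S\le\sum_i p_i$. *Strategies.* Strategic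 parties are computationally unbounded, may deviate arbitrarily, adaptively and randomly, may use any finite number of fake identities, and in each round see the messages that honest parties address to them or post before they send their own; a strategic platform also chooses the number of rounds and the final messages. *Incentive compatibility.* Let $\mathcal{D}$ be a probability distribution on $\mathbb{U}$. - $\Pi$ is *Bayesian bIC* with respect to $\mathcal{D}$ if for every finite set of $n_H\ge 0$ other buyers with any identities, who are honest and have values drawn independently from $\mathcal{D}$, and for every further buyer with any identity and any true value $w\in\mathbb{U}$, the platform and the seller being honest, no strategy of that buyer has larger expected utility than honest behaviour. The buyer's utility is $0$ if the platform rejects; otherwise it is $w$ if at least one of its identities receives an item (and $0$ if none does), minus the payments of those of its identities that receive an item. - $\Pi$ is *ex post psIC* if for every finite set of honest buyers with any values in $\mathbb{U}$, no strategy of the platform together with the seller that hands out at most $k$ items has larger expected utility than honest behaviour. The coalition's utility is the sum of the honest buyers' payments if all honest buyers accept, and $0$ otherwise. *Claim.* If $\Pi$ is Bayesian bIC with respect to $\mathcal{D}$ and ex post psIC, then $\Pi$ is revenue dominated by a posted price auction: there is a single reserve $r\ge 0$ such that for every finite set of buyers and every value vector $\mathbf{b}=(b_1,\dots,b_n)\in\mathbb{U}^n$,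 when everybody is honest, $$\mathbf{E}\Big[\sum_{i=1}^n p_i\Big]\;\le\;\sum_{i=1}^n r\cdot\mathbf{1}[b_i\ge r],$$ where the right-hand side is the revenue on $\mathbf{b}$ of the posted price auction with reserve $r$, in which every buyer faces the take-it-or-leave-it price $r$ independently of the other buyers. -/

import Mathlib

open scoped ENNReal NNReal

/-! ### Independent sampling and expectations -/

theorem tsum_prod_pmf_eq_one (ι : Type*) [Fintype ι] {α : Type*} (p : ι → PMF α) :
    ∑' f : ι → α, ∏ i, p i (f i) = 1 := by
  classical
  revert p
  refine Fintype.induction_empty_option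
    (P := fun ι _ => ∀ p : ι → PMF α, ∑' f : ι → α, ∏ i, p i (f i) = 1) ?_ ?_ ?_ ι
  · intro β γ _ e h p
    let _ := Fintype.ofEquiv γ e.symm
    have h' := h (fun b => p (e b))
    rw [← h', ← (Equiv.arrowCongr e (Equiv.refl α)).tsum_eq]
    refine tsum_congr fun f => ?_
    rw [← Fintype.prod_equiv e (fun b => (p (e b)) (f b)) _ (fun b => by simp)]
  · intro p
    rw [tsum_eq_single (fun x => PEmpty.elim x) (fun f hf => absurd (Subsingleton.elim _ _) hf)]
    simp
  · intro β _ h p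
    rw [← (Equiv.piOptionEquivProd (β := fun _ : Option β => α)).symm.tsum_eq, ENNReal.tsum_prod']
    simp only [Fintype.prod_option, Equiv.piOptionEquivProd_symm_apply]
    simp only [ENNReal.tsum_mul_left, h, mul_one, PMF.tsum_coe]

/-- Independent samples, one from each `p i`. -/
noncomputable def indepPMF {ι : Type*} [Fintype ι] {α : Type*} (p : ι → PMF α) : PMF (ι → α) :=
  ⟨fun f => ∏ i, p i (f i),
    (tsum_prod_pmf_eq_one ι p) ▸ ENNReal.summable.hasSum⟩

/-- `E[f⁺]` for a discrete distribution. The negative part is `posExp p (-f)`. -/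
noncomputable def posExp {α : Type*} (p : PMF α) (f : α → ℝ) : ℝ≥0∞ :=
  ∑' a, p a * ENNReal.ofReal (f a)

/-- The expectation `E[f⁺] - E[f⁻]`. All utilities below are bounded above, so `E[f⁺]` is finite
and the expectation is well defined, possibly `-∞`. -/
noncomputable def expect {α : Type*} (p : PMF α) (f : α → ℝ) : EReal :=
  (posExp p f : EReal) - (posExp p (fun a => -f a) : EReal)

/-- The expectation `E[f⁺] - E[f⁻]` in a two-stage experiment: `b` is drawn from `μ`, then
`a` is drawn from `p b`. -/
noncomputable def expectOver {β α : Type*} [MeasurableSpace β] (μ : MeasureTheory.Measure β)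
    (p : β → PMF α) (f : α → ℝ) : EReal :=
  ((∫⁻ b, posExp (p b) f ∂μ : ℝ≥0∞) : EReal) -
    ((∫⁻ b, posExp (p b) (fun a => -f a) ∂μ : ℝ≥0∞) : EReal)

namespace Auction

/-! ### Parties, rounds of communication and views -/

/-- The parties: the platform, the seller, and one potential buyer for every identity. -/
inductive Party (Id : Type*) where
  | platform : Party Id
  | seller : Party Id
  | buyer (i : Id) : Party Id

/-- Everything sent in one synchronous round (`none` means that nothing is sent):
`toPlatform q` goes privately from `q` to the platform, `fromPlatform q` goes privately from the
platform to `q`, and `board q` is posted by `q` on the broadcast channel. -/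
structure Round (Id Msg : Type*) where
  toPlatform : Party Id → Option Msg
  fromPlatform : Party Id → Option Msg
  board : Party Id → Option Msg

open Classical in
/-- The part of a round that is visible to the parties in `C`: the messages on their own private
channels (all private channels if the platform is in `C`) and the whole board. -/
noncomputable def Round.view {Id Msg : Type*} (C : Set (Party Id)) (R : Round Id Msg) :
    Round Id Msg where
  toPlatform q := if Party.platform ∈ C ∨ q ∈ C then R.toPlatform q else none
  fromPlatform q := if Party.platform ∈ C ∨ q ∈ C then R.fromPlatform q else none
  board := R.board

/-- The rounds so far, the most recent one first. -/
abbrev History (Id Msg : Type*) := List (Round Id Msg)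

/-- The view of the parties in `C`: all that they have sent or received so far. -/
noncomputable def History.view {Id Msg : Type*} (C : Set (Party Id)) (h : History Id Msg) :
    History Id Msg :=
  List.map (Round.view C) h

/-- What a buyer or the seller sends in one round. -/
structure Move (Msg : Type*) where
  toPlatform : Option Msg
  post : Option Msg

/-- What the platform sends in one round. -/
structure PlatformMove (Id Msg : Type*) where
  fromPlatform : Party Id → Option Msg
  post : Option Msg

/-- Private outcome of a buyer: number of items received and payment. -/
structure BuyerOutcome where
  items : ℕ
  pay : ℝ≥0

/-- Private outcome of the seller: total number of items sold and revenue. -/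
structure SellerOutcome where
  sold : ℕ
  revenue : ℝ≥0

/-- An outcome for every party, computed by an accepting honest platform. -/
structure Outcome (Id : Type*) where
  buyer : Id → BuyerOutcome
  seller : SellerOutcome

/-- The final messages of the platform; `none` is the message `⊥` (reject). -/
structure Notice (Id : Type*) where
  buyer : Id → Option BuyerOutcome
  seller : Option SellerOutcome

/-- An honest platform sends `⊥` to everybody or an outcome to everybody. -/
def Notice.ofOption {Id : Type*} : Option (Outcome Id) → Notice Id
  | none => ⟨fun _ => none, none⟩
  | some o => ⟨fun i => some (o.buyer i), some o.seller⟩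

/-! ### Protocols and strategies -/

/-- The honest programs. Every program gives the distribution of the next message (resp. of the
outcome or the final decision) of an honest party conditioned on its input and on its view, that
is, on everything that this party has sent and received so far; the private coin tosses are thereby
conditioned on the view. The input of the platform is the finite set of participating identities;
a buyer knows its identity and its value. -/
structure Protocol (Id Msg : Type*) where
  rounds : Finset Id → ℕ
  buyer : Id → ℝ≥0 → History Id Msg → PMF (Move Msg)
  seller : History Id Msg → PMF (Move Msg)
  platform : Finset Id → History Id Msg → PMF (PlatformMove Id Msg)
  /-- `none`: the platform rejects. -/
  outcome : Finset Id → History Id Msg → PMF (Option (Outcome Id))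
  buyerAccept : Id → ℝ≥0 → History Id Msg → BuyerOutcome → PMF Bool
  sellerAccept : History Id Msg → SellerOutcome → PMF Bool

/-- An unbounded, adaptive, randomized strategy of the strategic parties, who act jointly.
* `joins`: the identities under which they register as buyers;
* `act h R`: what they send in the current round, given their view `h` of the earlier rounds and
  what they see of the messages `R` that the honest parties send in the current round;
* `rounds`, `outcome`: the number of rounds and the final messages of the platform (used only if
  the platform is strategic). -/
structure Strategy (Id Msg : Type*) where
  joins : Finset Id
  act : History Id Msg → Round Id Msg → PMF (Round Id Msg)
  rounds : ℕ
  outcome : History Id Msg → PMF (Notice Id)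

/-- Nobody is strategic: no identity joins and nothing is sent. -/
noncomputable def Strategy.idle (Id Msg : Type*) : Strategy Id Msg where
  joins := ∅
  act _ _ := PMF.pure ⟨fun _ => none, fun _ => none, fun _ => none⟩
  rounds := 0
  outcome _ := PMF.pure ⟨fun _ => none, none⟩

/-- Who is honest, and the values that the honest buyers use. -/
structure World (Id : Type*) where
  buyers : Finset Id
  value : Id → ℝ≥0
  sellerHonest : Bool
  platformHonest : Bool

/-- All parties that are not honest, including the identities that no honest buyer uses. -/
def World.strategic {Id : Type*} (W : World Id) : Set (Party Id) :=
  fun q => match q with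
    | .platform => W.platformHonest = false
    | .seller => W.sellerHonest = false
    | .buyer i => i ∉ W.buyers

/-- The result of an execution: the final messages of the platform and the acceptance decisions
of the honest buyers and of the seller. -/
structure Trace (Id : Type*) where
  notice : Notice Id
  buyerAccepts : Id → Bool
  sellerAccepts : Bool

/-- The decision of an honest platform: it rejects by sending `⊥`. -/
def Trace.platformAccepts {Id : Type*} (tr : Trace Id) : Bool := tr.notice.seller.isSome

/-- Items received by buyer `i` (none after `⊥`). -/
def Trace.items {Id : Type*} (tr : Trace Id) (i : Id) : ℕ :=
  (tr.notice.buyer i).elim 0 BuyerOutcome.items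

/-- Payment of buyer `i` (none after `⊥`). -/
def Trace.pay {Id : Type*} (tr : Trace Id) (i : Id) : ℝ≥0 :=
  (tr.notice.buyer i).elim 0 BuyerOutcome.pay

section Execution

variable {Id Msg : Type*}

open Classical in
/-- The identities known to an honest platform. -/
noncomputable def participants (W : World Id) (S : Strategy Id Msg) : Finset Id :=
  W.buyers ∪ S.joins

open Classical in
/-- The messages of the honest parties in the round that follows the history `h`; independent
given `h`. -/
noncomputable def honestRound (P : Protocol Id Msg) (W : World Id) (S : Strategy Id Msg)
    (h : History Id Msg) : PMF (Round Id Msg) :=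
  (indepPMF fun i : W.buyers => P.buyer i (W.value i) (h.view {Party.buyer i.1})).bind fun b =>
  (if W.sellerHonest then P.seller (h.view {Party.seller})
    else PMF.pure ⟨none, none⟩).bind fun s =>
  (if W.platformHonest then P.platform (participants W S) (h.view {Party.platform})
    else PMF.pure ⟨fun _ => none, none⟩).map fun m =>
  { toPlatform := fun q => match q with
      | .platform => none
      | .seller => s.toPlatform
      | .buyer i => if hi : i ∈ W.buyers then (b ⟨i, hi⟩).toPlatform else none
    fromPlatform := m.fromPlatform
    board := fun q => match q with
      | .platform => m.post
      | .seller => s.post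
      | .buyer i => if hi : i ∈ W.buyers then (b ⟨i, hi⟩).post else none }

open Classical in
/-- Combine what the honest parties send with what the parties in `C` send; each message is
determined by its sender. -/
noncomputable def merge (C : Set (Party Id)) (honest adv : Round Id Msg) : Round Id Msg where
  toPlatform q := if q ∈ C then adv.toPlatform q else honest.toPlatform q
  fromPlatform q := if Party.platform ∈ C then adv.fromPlatform q else honest.fromPlatform q
  board q := if q ∈ C then adv.board q else honest.board q

/-- One round: the strategic parties see the messages that the honest parties send them in this
round before they send their own. -/
noncomputable def step (P : Protocol Id Msg) (W : World Id) (S : Strategy Id Msg)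
    (h : History Id Msg) : PMF (Round Id Msg) :=
  (honestRound P W S h).bind fun R =>
    (S.act (h.view W.strategic) (R.view W.strategic)).map fun A => merge W.strategic R A

/-- The history after `n` rounds. -/
noncomputable def run (P : Protocol Id Msg) (W : World Id) (S : Strategy Id Msg) :
    ℕ → PMF (History Id Msg)
  | 0 => PMF.pure []
  | n + 1 => (run P W S n).bind fun h => (step P W S h).map fun R => R :: h

/-- A complete execution: the rounds of communication, the final messages of the platform, and
the acceptance decisions. A party that receives `⊥` rejects. -/
noncomputable def exec (P : Protocol Id Msg) (W : World Id) (S : Strategy Id Msg) :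
    PMF (Trace Id) :=
  (run P W S (if W.platformHonest then P.rounds (participants W S) else S.rounds)).bind fun h =>
  (if W.platformHonest then
      (P.outcome (participants W S) (h.view {Party.platform})).map Notice.ofOption
    else S.outcome (h.view W.strategic)).bind fun n =>
  (indepPMF fun i : W.buyers => match n.buyer i with
    | none => PMF.pure false
    | some o => P.buyerAccept i (W.value i) (h.view {Party.buyer i.1}) o).bind fun a =>
  (match n.seller with
    | none => PMF.pure false
    | some o => P.sellerAccept (h.view {Party.seller}) o).map fun s =>
  open Classical in
  { notice := n
    buyerAccepts := fun i => if hi : i ∈ W.buyers then a ⟨i, hi⟩ else false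
    sellerAccepts := s }

/-- Everybody is honest and the buyers `H` have values `v`. -/
noncomputable def honestExec (P : Protocol Id Msg) (H : Finset Id) (v : Id → ℝ≥0) :
    PMF (Trace Id) :=
  exec P ⟨H, v, true, true⟩ (Strategy.idle Id Msg)

/-! ### Auctions -/

/-- The requirements on an auction of `k` identical items with value domain `U`. They hold with
probability one in every execution in which the honest buyers have values in `U`. -/
structure IsAuction (k : ℕ) (U : Set ℝ≥0) (P : Protocol Id Msg) : Prop where
  /-- If all parties are honest then everybody accepts. -/
  accept : ∀ (H : Finset Id) (v : Id → ℝ≥0), (∀ i ∈ H, v i ∈ U) →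
    ∀ tr ∈ (honestExec P H v).support,
      tr.platformAccepts = true ∧ tr.sellerAccepts = true ∧ ∀ i ∈ H, tr.buyerAccepts i = true
  /-- If the platform is honest then all honest parties agree on whether to accept. -/
  agree : ∀ (W : World Id) (S : Strategy Id Msg), W.platformHonest = true →
    (∀ i ∈ W.buyers, W.value i ∈ U) → ∀ tr ∈ (exec P W S).support,
      (∀ i ∈ W.buyers, tr.buyerAccepts i = tr.platformAccepts) ∧
      (W.sellerHonest = true → tr.sellerAccepts = tr.platformAccepts)
  /-- Individual rationality: an honest buyer only accepts a single item or none, at nonnegative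
  utility. -/
  rational : ∀ (W : World Id) (S : Strategy Id Msg), (∀ i ∈ W.buyers, W.value i ∈ U) →
    ∀ tr ∈ (exec P W S).support, ∀ i ∈ W.buyers, tr.buyerAccepts i = true →
      tr.items i ≤ 1 ∧ tr.pay i ≤ tr.items i * W.value i
  /-- If the platform is honest and accepts, then the numbers of items sold and received agree and
  are at most `k`, and the seller receives at most the total payment. -/
  consistent : ∀ (W : World Id) (S : Strategy Id Msg), W.platformHonest = true →
    (∀ i ∈ W.buyers, W.value i ∈ U) → ∀ tr ∈ (exec P W S).support,
      ∀ o : SellerOutcome, tr.notice.seller = some o →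
        o.sold = ∑ i ∈ participants W S, tr.items i ∧ o.sold ≤ k ∧
        o.revenue ≤ ∑ i ∈ participants W S, tr.pay i

/-! ### Utilities and incentive compatibility -/

open Classical in
/-- Utility, when the platform is honest, of a unit-demand buyer with true value `w` who takes part
under the identities `F`. It is `0` if the platform rejects; otherwise it is the value of an item if
one of the identities receives one, minus the payments of the identities that receive an item. -/
noncomputable def buyerUtil (F : Finset Id) (w : ℝ≥0) (tr : Trace Id) : ℝ :=
  if tr.platformAccepts then
    (if ∃ j ∈ F, 0 < tr.items j then (w : ℝ) else 0) -
      ∑ j ∈ F, if 0 < tr.items j then (tr.pay j : ℝ) else 0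
  else 0

open Classical in
/-- Utility of a platform-seller coalition facing the honest buyers `H`: the total payment of the
honest buyers if all of them accept (a safe trace), and `0` otherwise. -/
noncomputable def coalitionUtil (H : Finset Id) (tr : Trace Id) : ℝ :=
  if ∀ i ∈ H, tr.buyerAccepts i = true then ∑ i ∈ H, (tr.pay i : ℝ) else 0

open Classical in
/-- The values of the buyers in `H`, as a function on all identities. -/
noncomputable def extend (H : Finset Id) (b : H → ℝ≥0) (i : Id) : ℝ≥0 :=
  if hi : i ∈ H then b ⟨i, hi⟩ else 0

open Classical in
/-- Information-theoretic Bayesian buyer incentive compatibility with respect to the value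
distribution `D`: for every finite set `H` of other buyers, whose values are drawn independently
from `D`, every identity `i` and every true value `w` of the remaining buyer, no strategy of that
buyer (with the platform, the seller and the buyers in `H` honest) has a larger expected utility
than the honest one. -/
def BayesianBIC (U : Set ℝ≥0) (D : MeasureTheory.Measure ℝ≥0) (P : Protocol Id Msg) : Prop :=
  ∀ (H : Finset Id) (i : Id), i ∉ H → ∀ w ∈ U, ∀ S : Strategy Id Msg,
    expectOver (MeasureTheory.Measure.pi fun _ : H => D)
        (fun b => exec P ⟨H, extend H b, true, true⟩ S) (buyerUtil (S.joins \ H) w) ≤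
      expectOver (MeasureTheory.Measure.pi fun _ : H => D)
        (fun b => honestExec P (insert i H) (Function.update (extend H b) i w))
        (buyerUtil {i} w)

/-- A strategy of a platform-seller coalition hands out at most the `k` items that the seller
has. -/
def Strategy.Feasible (S : Strategy Id Msg) (k : ℕ) (H : Finset Id) : Prop :=
  ∀ h, ∀ n ∈ (S.outcome h).support,
    ∑ i ∈ H, (n.buyer i).elim 0 BuyerOutcome.items ≤ k

/-- Information-theoretic ex post platform-seller incentive compatibility: whatever the values of
the honest buyers, no strategy of the platform together with the seller has a larger expected
utility than the honest one. -/
def ExPostPSIC (k : ℕ) (U : Set ℝ≥0) (P : Protocol Id Msg) : Prop :=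
  ∀ (H : Finset Id) (v : Id → ℝ≥0), (∀ i ∈ H, v i ∈ U) →
    ∀ S : Strategy Id Msg, S.Feasible k H →
      expect (exec P ⟨H, v, false, false⟩ S) (coalitionUtil H) ≤
        expect (honestExec P H v) (coalitionUtil H)

/-! ### Revenue -/

/-- Expected total payment of the buyers `H` with values `v`, everybody being honest. -/
noncomputable def expectedRevenue (P : Protocol Id Msg) (H : Finset Id) (v : Id → ℝ≥0) : EReal :=
  expect (honestExec P H v) fun tr => ∑ i ∈ H, (tr.pay i : ℝ)

/-- Revenue of the posted price auction with reserve `r`: every buyer is made the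
take-it-or-leave-it offer `r`, so that exactly the buyers of value at least `r` buy at price `r`. -/
noncomputable def postedPriceRevenue (r : ℝ≥0) (H : Finset Id) (v : Id → ℝ≥0) : ℝ :=
  ∑ i ∈ H, if r ≤ v i then (r : ℝ) else 0

/-- A single reserve `r` works for all finite sets of buyers and all value vectors. -/
def RevenueDominatedByPostedPrice (U : Set ℝ≥0) (P : Protocol Id Msg) : Prop :=
  ∃ r : ℝ≥0, ∀ (H : Finset Id) (v : Id → ℝ≥0), (∀ i ∈ H, v i ∈ U) →
    expectedRevenue P H v ≤ ((postedPriceRevenue r H v : ℝ) : EReal)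

end Execution

end Auction

/-- The expectation of a nonnegative function under a discrete distribution. -/
noncomputable def PMF.mean {α : Type*} (p : PMF α) (f : α → ℝ≥0∞) : ℝ≥0∞ :=
  ∑' a, p a * f a

namespace PMF

variable {α β : Type*}

theorem mean_pure (a : α) (f : α → ℝ≥0∞) : (PMF.pure a).mean f = f a := by
  classical
  rw [mean, tsum_eq_single a (fun b hb => by simp [PMF.pure_apply, hb])]
  simp

theorem mean_bind (p : PMF α) (q : α → PMF β) (f : β → ℝ≥0∞) :
    (p.bind q).mean f = p.mean fun a => (q a).mean f := by
  simp only [mean, PMF.bind_apply, ← ENNReal.tsum_mul_left, ← ENNReal.tsum_mul_right]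
  rw [ENNReal.tsum_comm]
  simp only [mul_assoc]

theorem mean_map (p : PMF α) (g : α → β) (f : β → ℝ≥0∞) :
    (p.map g).mean f = p.mean fun a => f (g a) := by
  rw [← PMF.bind_pure_comp, mean_bind]
  simp [mean_pure]

theorem mean_const (p : PMF α) (c : ℝ≥0∞) : (p.mean fun _ => c) = c := by
  simp [mean, ENNReal.tsum_mul_right]

theorem mean_mono {p : PMF α} {f g : α → ℝ≥0∞} (h : ∀ a ∈ p.support, f a ≤ g a) :
    p.mean f ≤ p.mean g := by
  refine ENNReal.tsum_le_tsum fun a => ?_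
  by_cases ha : p a = 0
  · simp [ha]
  · gcongr
    exact h a ((p.mem_support_iff a).2 ha)

theorem mean_congr {p : PMF α} {f g : α → ℝ≥0∞} (h : ∀ a ∈ p.support, f a = g a) :
    p.mean f = p.mean g :=
  le_antisymm (mean_mono fun a ha => (h a ha).le) (mean_mono fun a ha => (h a ha).ge)

theorem mean_le {p : PMF α} {f : α → ℝ≥0∞} {c : ℝ≥0∞} (h : ∀ a ∈ p.support, f a ≤ c) :
    p.mean f ≤ c :=
  (mean_mono h).trans_eq (mean_const p c)

theorem le_mean {p : PMF α} {f : α → ℝ≥0∞} {c : ℝ≥0∞} (h : ∀ a ∈ p.support, c ≤ f a) :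
    c ≤ p.mean f :=
  (mean_const p c).symm.trans_le (mean_mono h)

theorem mean_const_mul (p : PMF α) (c : ℝ≥0∞) (f : α → ℝ≥0∞) :
    (p.mean fun a => c * f a) = c * p.mean f := by
  simp only [mean, ← ENNReal.tsum_mul_left, mul_left_comm]

theorem mean_add (p : PMF α) (f g : α → ℝ≥0∞) :
    (p.mean fun a => f a + g a) = p.mean f + p.mean g := by
  simp only [mean, mul_add, ENNReal.tsum_add]

theorem mean_sum {ι : Type*} (p : PMF α) (s : Finset ι) (f : ι → α → ℝ≥0∞) :
    (p.mean fun a => ∑ i ∈ s, f i a) = ∑ i ∈ s, p.mean (f i) := by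
  classical
  induction s using Finset.induction_on with
  | empty => simp [mean]
  | insert i s hi ih => simp only [Finset.sum_insert hi, mean_add, ih]

theorem eq_of_mean_le {p : PMF α} {f g : α → ℝ≥0∞} (h : ∀ a ∈ p.support, f a ≤ g a)
    (hle : p.mean g ≤ p.mean f) (hf : p.mean f ≠ ∞) : ∀ a ∈ p.support, f a = g a := by
  intro a ha
  refine (h a ha).antisymm (le_of_not_gt fun hlt => hle.not_gt ?_)
  refine ENNReal.tsum_lt_tsum (i := a) hf (fun b => ?_) ?_
  · by_cases hb : p b = 0
    · simp [hb]
    · gcongr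
      exact h b ((p.mem_support_iff b).2 hb)
  · exact (ENNReal.mul_lt_mul_iff_right ((p.mem_support_iff a).1 ha) (p.apply_ne_top a)).2 hlt

theorem bind_congr_support {p : PMF α} {f g : α → PMF β} (h : ∀ a ∈ p.support, f a = g a) :
    p.bind f = p.bind g := by
  ext b
  simp only [PMF.bind_apply]
  refine tsum_congr fun a => ?_
  by_cases ha : p a = 0
  · simp [ha]
  · rw [h a ((p.mem_support_iff a).2 ha)]

end PMF

theorem posExp_eq_mean {α : Type*} (p : PMF α) (f : α → ℝ) :
    posExp p f = p.mean fun a => ENNReal.ofReal (f a) := rfl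

theorem posExp_neg_eq_zero {α : Type*} {p : PMF α} {f : α → ℝ} (h : ∀ a ∈ p.support, 0 ≤ f a) :
    posExp p (fun a => -f a) = 0 := by
  rw [posExp_eq_mean, ← nonpos_iff_eq_zero]
  exact PMF.mean_le fun a ha => by simp [ENNReal.ofReal_eq_zero.2, h a ha]

theorem expect_of_nonneg {α : Type*} {p : PMF α} {f : α → ℝ} (h : ∀ a ∈ p.support, 0 ≤ f a) :
    expect p f = (posExp p f : EReal) := by
  simp [expect, posExp_neg_eq_zero h]

theorem expectOver_of_unique {β α : Type*} [MeasurableSpace β] [Unique β]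
    (μ : MeasureTheory.Measure β) [MeasureTheory.IsProbabilityMeasure μ] (p : β → PMF α)
    (f : α → ℝ) : expectOver μ p f = expect (p default) f := by
  simp [expectOver, expect, MeasureTheory.lintegral_unique]

section Indep

variable {ι α : Type*} [Fintype ι]

theorem indepPMF_apply (p : ι → PMF α) (f : ι → α) : indepPMF p f = ∏ i, p i (f i) := rfl

theorem mem_support_indepPMF (p : ι → PMF α) (f : ι → α) :
    f ∈ (indepPMF p).support ↔ ∀ i, f i ∈ (p i).support := by
  simp [PMF.mem_support_iff, indepPMF_apply, Finset.prod_eq_zero_iff]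

theorem exists_mem_support_indepPMF [DecidableEq ι] (p : ι → PMF α) (i : ι) {a : α}
    (ha : a ∈ (p i).support) : ∃ f ∈ (indepPMF p).support, f i = a := by
  choose g hg using fun j => (p j).support_nonempty
  refine ⟨Function.update g i a, (mem_support_indepPMF p _).2 fun j => ?_, by simp⟩
  by_cases hj : j = i
  · subst hj; simpa using ha
  · simpa [hj] using hg j

theorem indepPMF_eq_bind [DecidableEq ι] (p : ι → PMF α) (i : ι) :
    indepPMF p = (p i).bind fun a =>
      (indepPMF fun j : {j // j ≠ i} => p j).map fun g => (Equiv.funSplitAt i α).symm (a, g) := by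
  ext f
  obtain ⟨⟨a, g⟩, rfl⟩ := (Equiv.funSplitAt i α).symm.surjective f
  rw [PMF.bind_apply, tsum_eq_single a]
  · rw [PMF.map_apply, tsum_eq_single g]
    · simp only [indepPMF_apply, if_true]
      rw [Fintype.prod_eq_mul_prod_subtype_ne _ i]
      congr 1
      · simp
      · exact Finset.prod_congr rfl fun j _ => by simp [j.2]
    · intro g' hg'
      simp [hg'.symm]
  · intro a' ha'
    rw [PMF.map_apply, mul_eq_zero]
    right
    simp [ha'.symm]

theorem indepPMF_resample [DecidableEq ι] (p : ι → PMF α) (i : ι) :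
    ((p i).bind fun a => (indepPMF p).map fun f => Function.update f i a) = indepPMF p := by
  conv_rhs => rw [indepPMF_eq_bind p i]
  congr 1
  funext a
  rw [indepPMF_eq_bind p i, PMF.map_bind]
  simp only [PMF.map_comp]
  rw [← PMF.bind_const (p i) (PMF.map _ _)]
  congr 1
  funext a'
  congr 1
  funext g
  ext j
  by_cases hj : j = i
  · subst hj; simp
  · simp [hj]

theorem indepPMF_unique [Unique ι] (p : ι → PMF α) :
    indepPMF p = (p default).map fun a _ => a := by
  ext f
  rw [PMF.map_apply, tsum_eq_single (f default)]
  · have : f = fun _ => f default := by ext i; rw [Unique.eq_default i]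
    rw [if_pos this]
    simp [indepPMF_apply]
  · intro a ha
    rw [if_neg]
    rintro rfl
    exact ha rfl

end Indep

theorem exists_mem_mul_biSup_le {α : Type*} {s : Set α} (hs : s.Nonempty) {g : α → ℝ≥0∞}
    {B c : ℝ≥0∞} (hB : B ≠ ∞) (hg : ∀ a ∈ s, g a ≤ B) (hc : c < 1) :
    ∃ a ∈ s, c * ⨆ a ∈ s, g a ≤ g a := by
  have hle : ⨆ a ∈ s, g a ≤ B := iSup₂_le hg
  by_cases h0 : ⨆ a ∈ s, g a = 0
  · obtain ⟨a, ha⟩ := hs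
    exact ⟨a, ha, by rw [h0]; simp⟩
  · have hlt : c * ⨆ a ∈ s, g a < ⨆ a ∈ s, g a := by
      conv_rhs => rw [← one_mul (⨆ a ∈ s, g a)]
      exact (ENNReal.mul_lt_mul_iff_left h0 (ne_top_of_le_ne_top hB hle)).2 hc
    obtain ⟨a, ha⟩ := lt_iSup_iff.1 hlt
    obtain ⟨ha, h⟩ := lt_iSup_iff.1 ha
    exact ⟨a, ha, h.le⟩

theorem le_of_forall_pow_mul_le {n : ℕ} {x y : ℝ≥0∞} (h : ∀ c < 1, c ^ n * x ≤ y) : x ≤ y := by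
  have ht : Filter.Tendsto (fun c : ℝ≥0∞ => c ^ n * x) (nhdsWithin 1 (Set.Iio 1)) (nhds (1 * x)) := by
    refine ENNReal.Tendsto.mul_const ?_ (Or.inl one_ne_zero)
    have : Filter.Tendsto (fun c : ℝ≥0∞ => c ^ n) (nhds 1) (nhds (1 ^ n)) :=
      (ENNReal.continuous_pow n).tendsto 1
    rw [one_pow] at this
    exact this.mono_left nhdsWithin_le_nhds
  rw [one_mul] at ht
  have : (nhdsWithin (1 : ℝ≥0∞) (Set.Iio 1)).NeBot := nhdsLT_neBot_of_exists_lt ⟨0, zero_lt_one⟩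
  exact le_of_tendsto ht (Filter.eventually_of_mem self_mem_nhdsWithin h)

namespace Auction

variable {Id Msg : Type*}

/-- Everybody but the buyer `i`. -/
def others (i : Id) : Set (Party Id) := {q | q ≠ Party.buyer i}

@[simp]
theorem platform_mem_others (i : Id) : Party.platform ∈ others i := by simp [others]

@[simp]
theorem seller_mem_others (i : Id) : Party.seller ∈ others i := by simp [others]

@[simp]
theorem buyer_mem_others (i j : Id) : Party.buyer j ∈ others i ↔ j ≠ i := by simp [others]

@[simp]
theorem platform_mem_strategic (W : World Id) :
    Party.platform ∈ W.strategic ↔ W.platformHonest = false := Iff.rfl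

@[simp]
theorem seller_mem_strategic (W : World Id) :
    Party.seller ∈ W.strategic ↔ W.sellerHonest = false := Iff.rfl

@[simp]
theorem buyer_mem_strategic (W : World Id) (i : Id) :
    Party.buyer i ∈ W.strategic ↔ i ∉ W.buyers := Iff.rfl

theorem strategic_singleton (i : Id) (v : Id → ℝ≥0) :
    World.strategic ⟨{i}, v, false, false⟩ = others i := by
  ext q
  cases q <;> simp

theorem view_of_platform_mem {C : Set (Party Id)} (hC : Party.platform ∈ C) (R : Round Id Msg) :
    R.view C = R := by
  simp [Round.view, hC]

theorem history_view_of_platform_mem {C : Set (Party Id)} (hC : Party.platform ∈ C)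
    (h : History Id Msg) : h.view C = h := by
  unfold History.view
  conv_rhs => rw [← List.map_id h]
  exact List.map_congr_left fun R _ => view_of_platform_mem hC R

theorem view_view {C C' : Set (Party Id)} (hC : C ⊆ C') (R : Round Id Msg) :
    (R.view C').view C = R.view C := by
  simp only [Round.view, Round.mk.injEq, and_true]
  constructor <;> funext q
  all_goals
    by_cases h : Party.platform ∈ C ∨ q ∈ C
    · simp [h, h.imp (fun h => hC h) (fun h => hC h)]
    · simp [h]

theorem history_view_view {C C' : Set (Party Id)} (hC : C ⊆ C') (h : History Id Msg) :
    (h.view C').view C = h.view C := by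
  simp [History.view, view_view hC]

@[simp]
theorem length_view (C : Set (Party Id)) (h : History Id Msg) : (h.view C).length = h.length := by
  simp [History.view]

theorem participants_idle (H : Finset Id) (v : Id → ℝ≥0) (s t : Bool) :
    participants ⟨H, v, s, t⟩ (Strategy.idle Id Msg) = H := by
  simp [participants, Strategy.idle]

/-! ### Execution from the point of view of one honest buyer -/

open Classical in
/-- The round in which only the buyer `i` sends something. -/
noncomputable def soloRound (i : Id) (b : Move Msg) : Round Id Msg where
  toPlatform q := if q = .buyer i then b.toPlatform else none
  fromPlatform _ := none
  board q := if q = .buyer i then b.post else none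

/-- The messages of the buyer `i` of value `w` with view `y`. -/
noncomputable def buyerRound (P : Protocol Id Msg) (i : Id) (w : ℝ≥0) (y : History Id Msg) :
    PMF (Round Id Msg) :=
  (P.buyer i w y).map (soloRound i)

/-- One round of an execution in which the buyer `i` of value `w` is honest and everybody else
sends messages distributed according to `act`. -/
noncomputable def facingStep (P : Protocol Id Msg) (i : Id) (w : ℝ≥0)
    (act : History Id Msg → Round Id Msg → PMF (Round Id Msg)) (h : History Id Msg) :
    PMF (Round Id Msg) :=
  (buyerRound P i w (h.view {.buyer i})).bind fun R => (act h R).map (merge (others i) R)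

open Classical in
/-- The messages of a round, given those of each honest party. -/
noncomputable def assemble (H : Finset Id) (b : H → Move Msg) (s : Move Msg)
    (m : PlatformMove Id Msg) : Round Id Msg where
  toPlatform q := match q with
    | .platform => none
    | .seller => s.toPlatform
    | .buyer i => if hi : i ∈ H then (b ⟨i, hi⟩).toPlatform else none
  fromPlatform := m.fromPlatform
  board q := match q with
    | .platform => m.post
    | .seller => s.post
    | .buyer i => if hi : i ∈ H then (b ⟨i, hi⟩).post else none

theorem honestRound_eq (P : Protocol Id Msg) (W : World Id) (S : Strategy Id Msg)
    (h : History Id Msg) :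
    honestRound P W S h =
      (indepPMF fun i : W.buyers => P.buyer i (W.value i) (h.view {Party.buyer i.1})).bind fun b =>
      (if W.sellerHonest then P.seller (h.view {Party.seller})
        else PMF.pure ⟨none, none⟩).bind fun s =>
      (if W.platformHonest then P.platform (participants W S) (h.view {Party.platform})
        else PMF.pure ⟨fun _ => none, none⟩).map fun m => assemble W.buyers b s m := by
  unfold honestRound assemble
  rfl

theorem honestRound_singleton (P : Protocol Id Msg) (i : Id) (v : Id → ℝ≥0) (S : Strategy Id Msg)
    (h : History Id Msg) :
    honestRound P ⟨{i}, v, false, false⟩ S h = buyerRound P i (v i) (h.view {.buyer i}) := by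
  rw [honestRound_eq, indepPMF_unique]
  simp only [PMF.bind_map, PMF.pure_bind, PMF.pure_map, Bool.false_eq_true, if_false, buyerRound]
  rw [← PMF.bind_pure_comp]
  refine congrArg _ (funext fun b => congrArg PMF.pure ?_)
  simp only [assemble, soloRound, Round.mk.injEq, true_and]
  constructor <;> funext q <;> cases q <;> simp
  all_goals split_ifs <;> simp_all

theorem step_facing (P : Protocol Id Msg) (i : Id) (v : Id → ℝ≥0) (S : Strategy Id Msg)
    (h : History Id Msg) :
    step P ⟨{i}, v, false, false⟩ S h = facingStep P i (v i) S.act h := by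
  simp only [step, strategic_singleton, honestRound_singleton, facingStep,
    history_view_of_platform_mem (platform_mem_others i), view_of_platform_mem (platform_mem_others i)]

theorem step_idle (P : Protocol Id Msg) (H : Finset Id) (v : Id → ℝ≥0) (h : History Id Msg) :
    step P ⟨H, v, true, true⟩ (Strategy.idle Id Msg) h =
      honestRound P ⟨H, v, true, true⟩ (Strategy.idle Id Msg) h := by
  have hact : ∀ y R, (Strategy.idle Id Msg).act y R =
      PMF.pure ⟨fun _ => none, fun _ => none, fun _ => none⟩ := fun _ _ => rfl
  simp only [step, hact, PMF.pure_map]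
  change PMF.bind _ (PMF.pure ∘ fun R => merge _ R _) = _
  rw [PMF.bind_pure_comp, honestRound_eq]
  simp only [PMF.map_bind, PMF.map_comp]
  refine congrArg _ (funext fun b => congrArg _ (funext fun s => ?_))
  refine congrArg (fun f => PMF.map f _) (funext fun m => ?_)
  simp only [Function.comp, assemble, merge, Round.mk.injEq]
  refine ⟨?_, ?_, ?_⟩ <;> funext q <;> cases q <;> simp <;> tauto

theorem honestRound_resample (P : Protocol Id Msg) {H : Finset Id} {i : Id} (hi : i ∈ H)
    (v : Id → ℝ≥0) (h : History Id Msg) :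
    (buyerRound P i (v i) (h.view {.buyer i})).bind (fun R =>
      (honestRound P ⟨H, v, true, true⟩ (Strategy.idle Id Msg) h).map (merge (others i) R)) =
      honestRound P ⟨H, v, true, true⟩ (Strategy.idle Id Msg) h := by
  classical
  simp only [honestRound_eq]
  conv_rhs => rw [← indepPMF_resample _ (⟨i, hi⟩ : H)]
  simp only [buyerRound, PMF.bind_map, PMF.bind_bind, Function.comp_def, PMF.map_bind, PMF.map_comp]
  refine congrArg _ (funext fun a => congrArg _ (funext fun b => congrArg _ (funext fun s => ?_)))
  refine congrArg (fun f => PMF.map f _) (funext fun m => ?_)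
  simp only [assemble, merge, soloRound, Round.mk.injEq, platform_mem_others, if_true, true_and]
  constructor <;> funext q <;> cases q <;> simp [Function.update_apply]
  all_goals
    rename_i j
    by_cases hj : j = i
    · subst hj; simp [hi]
    · simp [hj]

theorem step_honest (P : Protocol Id Msg) {H : Finset Id} {i : Id} (hi : i ∈ H)
    (v : Id → ℝ≥0) (h : History Id Msg) :
    step P ⟨H, v, true, true⟩ (Strategy.idle Id Msg) h =
      facingStep P i (v i)
        (fun h _ => honestRound P ⟨H, v, true, true⟩ (Strategy.idle Id Msg) h) h := by
  rw [step_idle, facingStep, honestRound_resample P hi]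

theorem length_of_mem_run (P : Protocol Id Msg) (W : World Id) (S : Strategy Id Msg) {n : ℕ}
    {h : History Id Msg} (hh : h ∈ (run P W S n).support) : h.length = n := by
  induction n generalizing h with
  | zero => simp_all [run]
  | succ n ih =>
    simp only [run, PMF.mem_support_bind_iff, PMF.mem_support_map_iff] at hh
    obtain ⟨g, hg, R, -, rfl⟩ := hh
    simp [ih hg]

/-! ### The end of an execution -/

/-- Payment of buyer `i` according to the final messages of the platform. -/
def Notice.pay (n : Notice Id) (i : Id) : ℝ≥0 := (n.buyer i).elim 0 BuyerOutcome.pay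

/-- Items of buyer `i` according to the final messages of the platform. -/
def Notice.items (n : Notice Id) (i : Id) : ℕ := (n.buyer i).elim 0 BuyerOutcome.items

/-- The number of rounds of an execution. -/
noncomputable def numRounds (P : Protocol Id Msg) (W : World Id) (S : Strategy Id Msg) : ℕ :=
  if W.platformHonest then P.rounds (participants W S) else S.rounds

/-- The distribution of the final messages of the platform. -/
noncomputable def noticeLaw (P : Protocol Id Msg) (W : World Id) (S : Strategy Id Msg)
    (h : History Id Msg) : PMF (Notice Id) :=
  if W.platformHonest then
    (P.outcome (participants W S) (h.view {Party.platform})).map Notice.ofOption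
  else S.outcome (h.view W.strategic)

/-- The distribution of the acceptance decision of the buyer `i` of value `w` with view `y`. -/
noncomputable def acceptLaw (P : Protocol Id Msg) (i : Id) (w : ℝ≥0) (y : History Id Msg)
    (n : Notice Id) : PMF Bool :=
  (n.buyer i).elim (PMF.pure false) (P.buyerAccept i w y)

/-- The distribution of the acceptance decision of the seller with view `y`. -/
noncomputable def sellerAcceptLaw (P : Protocol Id Msg) (y : History Id Msg) (n : Notice Id) :
    PMF Bool :=
  n.seller.elim (PMF.pure false) (P.sellerAccept y)

open Classical in
theorem exec_eq (P : Protocol Id Msg) (W : World Id) (S : Strategy Id Msg) :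
    exec P W S = (run P W S (numRounds P W S)).bind fun h => (noticeLaw P W S h).bind fun n =>
      (indepPMF fun i : W.buyers =>
        acceptLaw P i.1 (W.value i) (h.view {Party.buyer i.1}) n).bind fun a =>
      (sellerAcceptLaw P (h.view {Party.seller}) n).map fun s =>
        { notice := n
          buyerAccepts := fun i => if hi : i ∈ W.buyers then a ⟨i, hi⟩ else false
          sellerAccepts := s } := by
  unfold exec
  refine congrArg _ (funext fun h => congrArg _ (funext fun n => ?_))
  have h1 : (fun i : W.buyers => acceptLaw P i.1 (W.value i) (h.view {Party.buyer i.1}) n) =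
      fun i : W.buyers => match n.buyer i with
        | none => PMF.pure false
        | some o => P.buyerAccept i (W.value i) (h.view {Party.buyer i.1}) o := by
    funext i
    unfold acceptLaw
    cases n.buyer i <;> rfl
  have h2 : sellerAcceptLaw P (h.view {Party.seller}) n =
      match n.seller with
        | none => PMF.pure false
        | some o => P.sellerAccept (h.view {Party.seller}) o := by
    unfold sellerAcceptLaw
    cases n.seller <;> rfl
  rw [h1, h2]

theorem mean_exec_notice (P : Protocol Id Msg) (W : World Id) (S : Strategy Id Msg)
    (f : Notice Id → ℝ≥0∞) :
    ((exec P W S).mean fun tr => f tr.notice) =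
      (run P W S (numRounds P W S)).mean fun h => (noticeLaw P W S h).mean f := by
  simp only [exec_eq, PMF.mean_bind, PMF.mean_map, PMF.mean_const]

theorem exists_of_mem_exec {P : Protocol Id Msg} {W : World Id} {S : Strategy Id Msg}
    {tr : Trace Id} (htr : tr ∈ (exec P W S).support) :
    ∃ h ∈ (run P W S (numRounds P W S)).support, tr.notice ∈ (noticeLaw P W S h).support ∧
      ∀ i ∈ W.buyers, tr.buyerAccepts i ∈
        (acceptLaw P i (W.value i) (h.view {Party.buyer i}) tr.notice).support := by
  rw [exec_eq] at htr
  simp only [PMF.mem_support_bind_iff, PMF.mem_support_map_iff, mem_support_indepPMF] at htr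
  obtain ⟨h, hh, n, hn, a, ha, s, -, rfl⟩ := htr
  refine ⟨h, hh, hn, fun i hi => ?_⟩
  simpa [hi] using ha ⟨i, hi⟩

theorem exists_mem_exec {P : Protocol Id Msg} {W : World Id} {S : Strategy Id Msg}
    {h : History Id Msg} (hh : h ∈ (run P W S (numRounds P W S)).support) {n : Notice Id}
    (hn : n ∈ (noticeLaw P W S h).support) :
    ∃ tr ∈ (exec P W S).support, tr.notice = n := by
  classical
  obtain ⟨a, ha⟩ := (indepPMF fun i : W.buyers =>
    acceptLaw P i.1 (W.value i) (h.view {Party.buyer i.1}) n).support_nonempty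
  obtain ⟨s, hs⟩ := (sellerAcceptLaw P (h.view {Party.seller}) n).support_nonempty
  refine ⟨⟨n, fun i => if hi : i ∈ W.buyers then a ⟨i, hi⟩ else false, s⟩, ?_, rfl⟩
  rw [exec_eq]
  simp only [PMF.mem_support_bind_iff, PMF.mem_support_map_iff]
  exact ⟨h, hh, n, hn, a, ha, s, hs, rfl⟩

theorem exists_mem_exec_of_accept {P : Protocol Id Msg} {W : World Id} {S : Strategy Id Msg}
    {h : History Id Msg} (hh : h ∈ (run P W S (numRounds P W S)).support) {n : Notice Id}
    (hn : n ∈ (noticeLaw P W S h).support) {i : Id} (hi : i ∈ W.buyers) {c : Bool}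
    (hc : c ∈ (acceptLaw P i (W.value i) (h.view {Party.buyer i}) n).support) :
    ∃ tr ∈ (exec P W S).support, tr.buyerAccepts i = c := by
  classical
  obtain ⟨a, ha, hac⟩ := exists_mem_support_indepPMF (fun i : W.buyers =>
    acceptLaw P i.1 (W.value i) (h.view {Party.buyer i.1}) n) ⟨i, hi⟩ hc
  obtain ⟨s, hs⟩ := (sellerAcceptLaw P (h.view {Party.seller}) n).support_nonempty
  refine ⟨⟨n, fun i => if hi : i ∈ W.buyers then a ⟨i, hi⟩ else false, s⟩, ?_, ?_⟩
  · rw [exec_eq]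
    simp only [PMF.mem_support_bind_iff, PMF.mem_support_map_iff]
    exact ⟨h, hh, n, hn, a, ha, s, hs, rfl⟩
  · simpa [hi] using hac

theorem honestExec_congr (P : Protocol Id Msg) {H : Finset Id} {v v' : Id → ℝ≥0}
    (hv : ∀ i ∈ H, v i = v' i) : honestExec P H v = honestExec P H v' := by
  have hv' : ∀ i : H, v i = v' i := fun i => hv i i.2
  have hround : honestRound P ⟨H, v, true, true⟩ (Strategy.idle Id Msg) =
      honestRound P ⟨H, v', true, true⟩ (Strategy.idle Id Msg) := by
    funext h
    simp only [honestRound_eq, hv']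
    rfl
  have hrun : ∀ n, run P ⟨H, v, true, true⟩ (Strategy.idle Id Msg) n =
      run P ⟨H, v', true, true⟩ (Strategy.idle Id Msg) n := by
    intro n
    induction n with
    | zero => rfl
    | succ n ih => simp only [run, step_idle, ih, hround]
  simp only [honestExec, exec_eq, hrun, hv']
  rfl

/-! ### Honest executions -/

section Honest

variable {k : ℕ} {U : Set ℝ≥0} {P : Protocol Id Msg} (hP : IsAuction k U P)
  {H : Finset Id} {v : Id → ℝ≥0} (hv : ∀ i ∈ H, v i ∈ U)

include hP hv

theorem honest_rational {tr : Trace Id} (htr : tr ∈ (honestExec P H v).support) {i : Id}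
    (hi : i ∈ H) : tr.items i ≤ 1 ∧ tr.pay i ≤ tr.items i * v i :=
  hP.rational _ _ hv tr htr i hi ((hP.accept H v hv tr htr).2.2 i hi)

theorem honest_pay_le {tr : Trace Id} (htr : tr ∈ (honestExec P H v).support) {i : Id}
    (hi : i ∈ H) : tr.pay i ≤ v i := by
  obtain ⟨h1, h2⟩ := honest_rational hP hv htr hi
  refine h2.trans ?_
  have : (tr.items i : ℝ≥0) ≤ 1 := by exact_mod_cast h1
  exact mul_le_of_le_one_left' this

theorem honest_sum_items_le {tr : Trace Id} (htr : tr ∈ (honestExec P H v).support) :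
    ∑ i ∈ H, tr.items i ≤ k := by
  have hacc := (hP.accept H v hv tr htr).1
  obtain ⟨o, ho⟩ := Option.isSome_iff_exists.1 hacc
  obtain ⟨h1, h2, -⟩ := hP.consistent _ _ rfl hv tr htr o ho
  rw [participants_idle] at h1
  exact h1 ▸ h2

theorem honest_coalitionUtil {tr : Trace Id} (htr : tr ∈ (honestExec P H v).support) :
    coalitionUtil H tr = ∑ i ∈ H, (tr.pay i : ℝ) :=
  if_pos (hP.accept H v hv tr htr).2.2

end Honest

/-- Everybody is honest and the buyers `H` have values `v`. -/
abbrev honestWorld (H : Finset Id) (v : Id → ℝ≥0) : World Id := ⟨H, v, true, true⟩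

/-- The history of an honest execution after `n` rounds. -/
noncomputable abbrev honestRun (P : Protocol Id Msg) (H : Finset Id) (v : Id → ℝ≥0) (n : ℕ) :
    PMF (History Id Msg) :=
  run P (honestWorld H v) (Strategy.idle Id Msg) n

/-- The final messages of a platform that is honest in an honest execution. -/
noncomputable abbrev honestNotice (P : Protocol Id Msg) (H : Finset Id) (v : Id → ℝ≥0)
    (h : History Id Msg) : PMF (Notice Id) :=
  noticeLaw P (honestWorld H v) (Strategy.idle Id Msg) h

/-- The expected payment of the buyer `i` of value `w` who takes part alone. -/
noncomputable def revenue (P : Protocol Id Msg) (i : Id) (w : ℝ≥0) : ℝ≥0∞ :=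
  (honestExec P {i} fun _ => w).mean fun tr => tr.pay i

theorem numRounds_honest (P : Protocol Id Msg) (H : Finset Id) (v : Id → ℝ≥0) :
    numRounds P (honestWorld H v) (Strategy.idle Id Msg) = P.rounds H := by
  simp [numRounds, participants_idle]

theorem mean_honest_pay (P : Protocol Id Msg) (H : Finset Id) (v : Id → ℝ≥0) (i : Id) :
    ((honestExec P H v).mean fun tr => (tr.pay i : ℝ≥0∞)) =
      (honestRun P H v (P.rounds H)).mean fun h =>
        (honestNotice P H v h).mean fun n => (n.pay i : ℝ≥0∞) := by
  rw [← numRounds_honest P H v]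
  exact mean_exec_notice P _ _ fun n => (n.pay i : ℝ≥0∞)

/-- The final messages that may follow the view `y` of the buyer `i` in an honest execution. -/
def credible (P : Protocol Id Msg) (H : Finset Id) (v : Id → ℝ≥0) (i : Id) (y : History Id Msg) :
    Set (Notice Id) :=
  {n | ∃ g ∈ (honestRun P H v (P.rounds H)).support, g.view {.buyer i} = y ∧
    n ∈ (honestNotice P H v g).support}

section Credible

variable {k : ℕ} {U : Set ℝ≥0} {P : Protocol Id Msg} (hP : IsAuction k U P)
  {H : Finset Id} {v : Id → ℝ≥0} (hv : ∀ i ∈ H, v i ∈ U) {i : Id} (hi : i ∈ H)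
  {y : History Id Msg} {n : Notice Id}

theorem exists_trace_of_credible (hn : n ∈ credible P H v i y) :
    ∃ tr ∈ (honestExec P H v).support, tr.notice = n := by
  obtain ⟨g, hg, -, hn⟩ := hn
  exact exists_mem_exec (by rwa [numRounds_honest]) hn

include hP hv hi

theorem accept_of_credible (hn : n ∈ credible P H v i y) {c : Bool}
    (hc : c ∈ (acceptLaw P i (v i) y n).support) : c = true := by
  obtain ⟨g, hg, rfl, hn⟩ := hn
  obtain ⟨tr, htr, rfl⟩ := exists_mem_exec_of_accept (W := honestWorld H v)
    (by rwa [numRounds_honest]) hn hi hc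
  exact (hP.accept H v hv tr htr).2.2 i hi

theorem pay_le_of_credible (hn : n ∈ credible P H v i y) : n.pay i ≤ v i := by
  obtain ⟨tr, htr, rfl⟩ := exists_trace_of_credible hn
  exact honest_pay_le hP hv htr hi

theorem items_le_of_credible (hn : n ∈ credible P H v i y) : n.items i ≤ k := by
  obtain ⟨tr, htr, rfl⟩ := exists_trace_of_credible hn
  exact (Finset.single_le_sum (f := fun i => tr.items i) (fun _ _ => Nat.zero_le _) hi).trans
    (honest_sum_items_le hP hv htr)

end Credible

section Coalition

variable {k : ℕ} {U : Set ℝ≥0} {P : Protocol Id Msg} (hP : IsAuction k U P)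
  (hpsIC : ExPostPSIC k U P)

include hP hpsIC

/-- The payment that a coalition extracts from a lone honest buyer without making it reject is at
most the honest revenue. -/
theorem mean_pay_le_revenue {i : Id} {w : ℝ≥0} (hw : w ∈ U) {S : Strategy Id Msg}
    (hk : S.Feasible k {i})
    (hS : ∀ h ∈ (run P ⟨{i}, fun _ => w, false, false⟩ S S.rounds).support,
      ∀ n ∈ (S.outcome h).support, ∀ c ∈ (acceptLaw P i w (h.view {.buyer i}) n).support,
        c = true) :
    ((run P ⟨{i}, fun _ => w, false, false⟩ S S.rounds).mean fun h =>
      (S.outcome h).mean fun n => (n.pay i : ℝ≥0∞)) ≤ revenue P i w := by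
  have hU : ∀ j ∈ ({i} : Finset Id), (fun _ : Id => w) j ∈ U := fun _ _ => hw
  have hlaw : ∀ h, noticeLaw P ⟨{i}, fun _ => w, false, false⟩ S h = S.outcome h := fun h => by
    simp [noticeLaw, strategic_singleton, history_view_of_platform_mem]
  have h := hpsIC {i} (fun _ => w) hU S hk
  have hnonneg : ∀ tr : Trace Id, 0 ≤ coalitionUtil {i} tr := fun tr => by
    unfold coalitionUtil
    split_ifs
    · exact Finset.sum_nonneg fun _ _ => NNReal.coe_nonneg _
    · exact le_rfl
  rw [expect_of_nonneg fun tr _ => hnonneg tr, expect_of_nonneg fun tr _ => hnonneg tr,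
    EReal.coe_ennreal_le_coe_ennreal_iff, posExp_eq_mean, posExp_eq_mean] at h
  have h1 : ((exec P ⟨{i}, fun _ => w, false, false⟩ S).mean fun tr =>
      ENNReal.ofReal (coalitionUtil {i} tr)) =
      (exec P ⟨{i}, fun _ => w, false, false⟩ S).mean fun tr => (tr.notice.pay i : ℝ≥0∞) := by
    refine PMF.mean_congr fun tr htr => ?_
    obtain ⟨g, hg, hn, hacc⟩ := exists_of_mem_exec htr
    rw [hlaw] at hn
    have := hS g hg _ hn _ (hacc i (by simp))
    rw [coalitionUtil, if_pos (by simpa using this), Finset.sum_singleton]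
    exact ENNReal.ofReal_coe_nnreal
  have h2 : ((honestExec P {i} fun _ => w).mean fun tr =>
      ENNReal.ofReal (coalitionUtil {i} tr)) = revenue P i w := by
    refine PMF.mean_congr fun tr htr => ?_
    rw [honest_coalitionUtil hP hU htr, Finset.sum_singleton]
    exact ENNReal.ofReal_coe_nnreal
  rw [h1, h2, mean_exec_notice P _ _ fun n => (n.pay i : ℝ≥0∞)] at h
  simp only [hlaw] at h
  exact h

open Classical in
/-- Facing the buyer `i`, simulate an honest execution with the buyers `H`. -/
noncomputable def simulation (P : Protocol Id Msg) (H : Finset Id) (v : Id → ℝ≥0) (k : ℕ) (i : Id) :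
    Strategy Id Msg where
  joins := ∅
  act h _ := honestRound P (honestWorld H v) (Strategy.idle Id Msg) h
  rounds := P.rounds H
  outcome h := (honestNotice P H v h).map fun n =>
    if n.items i ≤ k then n else ⟨fun _ => none, none⟩

/-- In the presence of other buyers, a buyer does not pay more than it pays alone. -/
theorem mean_pay_le_alone {H : Finset Id} {v : Id → ℝ≥0} (hv : ∀ i ∈ H, v i ∈ U) {i : Id}
    (hi : i ∈ H) :
    ((honestExec P H v).mean fun tr => (tr.pay i : ℝ≥0∞)) ≤ revenue P i (v i) := by
  have hrun : ∀ n, run P ⟨{i}, fun _ => v i, false, false⟩ (simulation P H v k i) n =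
      honestRun P H v n := by
    intro n
    induction n with
    | zero => rfl
    | succ n ih =>
      simp only [honestRun] at ih
      simp only [honestRun, run, ih, step_facing, step_honest P hi]
      rfl
  have hout : ∀ h ∈ (honestRun P H v (P.rounds H)).support,
      (simulation P H v k i).outcome h = honestNotice P H v h := by
    intro h hh
    conv_rhs => rw [← PMF.map_id (honestNotice P H v h)]
    simp only [simulation, ← PMF.bind_pure_comp]
    refine PMF.bind_congr_support fun n hn => ?_
    simp [items_le_of_credible hP hv hi ⟨h, hh, rfl, hn⟩]
  rw [mean_honest_pay]
  refine le_of_eq_of_le ?_ (mean_pay_le_revenue hP hpsIC (hv i hi) (S := simulation P H v k i) ?_ ?_)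
  · rw [hrun]
    exact PMF.mean_congr fun h hh => by rw [hout h hh]
  · intro h n hn
    simp only [simulation, PMF.mem_support_map_iff] at hn
    obtain ⟨n, -, rfl⟩ := hn
    rw [Finset.sum_singleton]
    split_ifs with h
    · exact h
    · simp
  · rw [hrun]
    intro h hh n hn c hc
    rw [hout h hh] at hn
    exact accept_of_credible hP hv hi ⟨h, hh, rfl, hn⟩ hc

end Coalition

/-! ### The lone buyer against an optimal coalition -/

section Value

variable (P : Protocol Id Msg) (i : Id) (w : ℝ≥0)

/-- The history of an honest execution with the single buyer `i` of value `w`. -/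
noncomputable abbrev aloneRun (n : ℕ) : PMF (History Id Msg) :=
  honestRun P {i} (fun _ => w) n

/-- The messages of the honest parties in an execution with the single buyer `i` of value `w`. -/
noncomputable abbrev aloneRound (h : History Id Msg) : PMF (Round Id Msg) :=
  honestRound P (honestWorld {i} fun _ => w) (Strategy.idle Id Msg) h

/-- What the others may send in an honest execution after the view `y` of the buyer `i`. -/
def safeRounds (y : History Id Msg) : Set (Round Id Msg) :=
  {A | ∃ g ∈ (aloneRun P i w y.length).support, g.view {.buyer i} = y ∧
    A ∈ (aloneRound P i w g).support}

/-- The view of the buyer `i` after a further round, in which it sends `R` and the others `A`. -/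
noncomputable def nextView (y : History Id Msg) (R A : Round Id Msg) : History Id Msg :=
  (merge (others i) R A).view {.buyer i} :: y

/-- The payment that a coalition can extract from the buyer `i` in the remaining rounds after the
view `y`, if it only sends messages that may occur in an honest execution. -/
noncomputable def coalitionValue : ℕ → History Id Msg → ℝ≥0∞
  | 0, y => ⨆ n ∈ credible P {i} (fun _ => w) i y, (n.pay i : ℝ≥0∞)
  | m + 1, y => (buyerRound P i w y).mean fun R =>
      ⨆ A ∈ safeRounds P i w y, coalitionValue m (nextView i y R A)

variable {P i w}

theorem nextView_view (h : History Id Msg) (R A : Round Id Msg) :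
    nextView i (h.view {.buyer i}) R A =
      History.view {.buyer i} (merge (others i) R A :: h) := rfl

theorem mem_aloneRun_succ {n : ℕ} {h : History Id Msg} :
    h ∈ (aloneRun P i w (n + 1)).support ↔ ∃ g ∈ (aloneRun P i w n).support,
      ∃ R ∈ (buyerRound P i w (g.view {.buyer i})).support, ∃ A ∈ (aloneRound P i w g).support,
        merge (others i) R A :: g = h := by
  simp only [aloneRun, honestRun, run, PMF.mem_support_bind_iff, PMF.mem_support_map_iff,
    step_honest P (Finset.mem_singleton_self i), facingStep]
  constructor
  · rintro ⟨g, hg, _, ⟨R, hR, A, hA, rfl⟩, rfl⟩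
    exact ⟨g, hg, R, hR, A, hA, rfl⟩
  · rintro ⟨g, hg, R, hR, A, hA, rfl⟩
    exact ⟨g, hg, _, ⟨R, hR, A, hA, rfl⟩, rfl⟩

theorem mem_safeRounds {n : ℕ} {h : History Id Msg} (hh : h ∈ (aloneRun P i w n).support)
    {A : Round Id Msg} (hA : A ∈ (aloneRound P i w h).support) :
    A ∈ safeRounds P i w (h.view {.buyer i}) :=
  ⟨h, by rwa [length_view, length_of_mem_run _ _ _ hh], rfl, hA⟩

theorem coalitionValue_le {k : ℕ} {U : Set ℝ≥0} (hP : IsAuction k U P) (hw : w ∈ U) (m : ℕ)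
    (y : History Id Msg) : coalitionValue P i w m y ≤ w := by
  induction m generalizing y with
  | zero =>
    refine iSup₂_le fun n hn => ?_
    exact_mod_cast pay_le_of_credible hP (fun _ _ => hw) (Finset.mem_singleton_self i) hn
  | succ m ih => exact PMF.mean_le fun R _ => iSup₂_le fun A _ => ih _

/-! ### Nearly optimal coalitions -/

variable (P i w) in
open Classical in
/-- A coalition that achieves `coalitionValue` up to a factor `c` per round. -/
noncomputable def nearOptimal (k : ℕ) (c : ℝ≥0∞) : Strategy Id Msg where
  joins := ∅
  act h R :=
    if hA : ∃ A ∈ safeRounds P i w (h.view {.buyer i}),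
        c * ⨆ A ∈ safeRounds P i w (h.view {.buyer i}),
          coalitionValue P i w (P.rounds {i} - h.length - 1) (nextView i (h.view {.buyer i}) R A) ≤
        coalitionValue P i w (P.rounds {i} - h.length - 1) (nextView i (h.view {.buyer i}) R A)
    then PMF.pure hA.choose else PMF.pure ⟨fun _ => none, fun _ => none, fun _ => none⟩
  rounds := P.rounds {i}
  outcome h :=
    if hn : ∃ n ∈ credible P {i} (fun _ => w) i (h.view {.buyer i}), n.items i ≤ k ∧
        c * coalitionValue P i w 0 (h.view {.buyer i}) ≤ n.pay i
    then PMF.pure hn.choose else PMF.pure ⟨fun _ => none, none⟩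

section

variable {k : ℕ} {U : Set ℝ≥0} (hP : IsAuction k U P) (hw : w ∈ U) {c : ℝ≥0∞} (hc : c < 1)

theorem nearOptimal_feasible : (nearOptimal P i w k c).Feasible k {i} := by
  intro h n hn
  rw [Finset.sum_singleton]
  simp only [nearOptimal] at hn
  split_ifs at hn with hex
  · rw [PMF.mem_support_pure_iff] at hn
    exact hn ▸ hex.choose_spec.2.1
  · rw [PMF.mem_support_pure_iff] at hn
    simp [hn]

include hP hw hc

theorem nearOptimal_act {h g : History Id Msg} (hg : g ∈ (aloneRun P i w h.length).support)
    (hgh : g.view {.buyer i} = h.view {.buyer i}) (R : Round Id Msg) :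
    ∃ A ∈ safeRounds P i w (h.view {.buyer i}),
      (nearOptimal P i w k c).act h R = PMF.pure A ∧
      c * ⨆ A ∈ safeRounds P i w (h.view {.buyer i}),
          coalitionValue P i w (P.rounds {i} - h.length - 1) (nextView i (h.view {.buyer i}) R A) ≤
        coalitionValue P i w (P.rounds {i} - h.length - 1)
          (nextView i (h.view {.buyer i}) R A) := by
  obtain ⟨A, hA⟩ := (aloneRound P i w g).support_nonempty
  have hex := exists_mem_mul_biSup_le ⟨A, hgh ▸ mem_safeRounds hg hA⟩ ENNReal.coe_ne_top
    (fun A _ => coalitionValue_le (i := i) hP hw (P.rounds {i} - h.length - 1)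
      (nextView i (h.view {.buyer i}) R A)) hc
  exact ⟨hex.choose, hex.choose_spec.1, dif_pos hex, hex.choose_spec.2⟩

theorem nearOptimal_outcome {h g : History Id Msg}
    (hg : g ∈ (aloneRun P i w (P.rounds {i})).support)
    (hgh : g.view {.buyer i} = h.view {.buyer i}) :
    ∃ n ∈ credible P {i} (fun _ => w) i (h.view {.buyer i}),
      (nearOptimal P i w k c).outcome h = PMF.pure n ∧
      c * coalitionValue P i w 0 (h.view {.buyer i}) ≤ n.pay i := by
  obtain ⟨n, hn⟩ := (honestNotice P {i} (fun _ => w) g).support_nonempty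
  have hU : ∀ j ∈ ({i} : Finset Id), (fun _ : Id => w) j ∈ U := fun _ _ => hw
  obtain ⟨n, hn, hle⟩ := exists_mem_mul_biSup_le
    (s := credible P {i} (fun _ => w) i (h.view {.buyer i})) ⟨n, g, hg, hgh, hn⟩
    (g := fun n => (n.pay i : ℝ≥0∞)) (B := w) ENNReal.coe_ne_top
    (fun n hn => by exact_mod_cast pay_le_of_credible hP hU (Finset.mem_singleton_self i) hn) hc
  have hex : ∃ n ∈ credible P {i} (fun _ => w) i (h.view {.buyer i}), n.items i ≤ k ∧
      c * coalitionValue P i w 0 (h.view {.buyer i}) ≤ n.pay i :=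
    ⟨n, hn, items_le_of_credible hP hU (Finset.mem_singleton_self i) hn, hle⟩
  exact ⟨hex.choose, hex.choose_spec.1, dif_pos hex, hex.choose_spec.2.2⟩

/-- The history of an execution with a nearly optimal coalition. -/
theorem nearOptimal_run {m : ℕ} {h : History Id Msg}
    (hh : h ∈ (run P ⟨{i}, fun _ => w, false, false⟩ (nearOptimal P i w k c) m).support) :
    ∃ g ∈ (aloneRun P i w m).support, g.view {.buyer i} = h.view {.buyer i} := by
  induction m generalizing h with
  | zero =>
    have : h = [] := List.length_eq_zero_iff.1 (length_of_mem_run _ _ _ hh)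
    subst this
    exact ⟨[], by simp [run], rfl⟩
  | succ m ih =>
    simp only [run, PMF.mem_support_bind_iff, PMF.mem_support_map_iff, step_facing,
      facingStep] at hh
    obtain ⟨h, hh, _, ⟨R, hR, A, hA, rfl⟩, rfl⟩ := hh
    obtain ⟨g, hg, hgh⟩ := ih hh
    have hlen := length_of_mem_run _ _ _ hh
    obtain ⟨A', ⟨g', hg', hview, hA'⟩, hact, -⟩ := nearOptimal_act (k := k) hP hw hc
      (hlen ▸ hg) hgh R
    rw [hact, PMF.mem_support_pure_iff] at hA
    subst hA
    rw [length_view, hlen] at hg'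
    refine ⟨merge (others i) R A :: g', mem_aloneRun_succ.2 ⟨g', hg', R, ?_, A, hA', rfl⟩, ?_⟩
    · rwa [hview]
    · rw [← nextView_view, hview, nextView_view]

theorem pow_mul_le_mean_nearOptimal {m : ℕ} (hm : m ≤ P.rounds {i}) :
    c ^ m * coalitionValue P i w (P.rounds {i}) [] ≤
      (run P ⟨{i}, fun _ => w, false, false⟩ (nearOptimal P i w k c) m).mean fun h =>
        coalitionValue P i w (P.rounds {i} - m) (h.view {.buyer i}) := by
  induction m with
  | zero => simp [run, PMF.mean_pure, History.view]
  | succ m ih =>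
    rw [pow_succ', mul_assoc]
    refine (mul_le_mul_right (ih (by omega)) c).trans ?_
    rw [← PMF.mean_const_mul]
    simp only [run, PMF.mean_bind, PMF.mean_map, step_facing, facingStep]
    refine PMF.mean_mono fun h hh => ?_
    obtain ⟨g, hg, hgh⟩ := nearOptimal_run hP hw hc hh
    have hlen := length_of_mem_run _ _ _ hh
    obtain ⟨j, hj⟩ : ∃ j, P.rounds {i} - m = j + 1 := ⟨P.rounds {i} - m - 1, by omega⟩
    have hj' : P.rounds {i} - (m + 1) = j := by omega
    have hj'' : P.rounds {i} - h.length - 1 = j := by omega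
    rw [hj, hj', coalitionValue, ← PMF.mean_const_mul]
    refine PMF.mean_mono fun R _ => ?_
    obtain ⟨A, -, hact, hle⟩ := nearOptimal_act (k := k) hP hw hc (hlen ▸ hg) hgh R
    rw [hact, PMF.mean_pure, ← nextView_view]
    rwa [hj''] at hle

end

theorem mean_aloneRound_le {n : ℕ} {h : History Id Msg} (hh : h ∈ (aloneRun P i w n).support)
    (R : Round Id Msg) (j : ℕ) :
    ((aloneRound P i w h).mean fun A => coalitionValue P i w j (nextView i (h.view {.buyer i}) R A)) ≤
      ⨆ A ∈ safeRounds P i w (h.view {.buyer i}),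
        coalitionValue P i w j (nextView i (h.view {.buyer i}) R A) :=
  PMF.mean_le fun A hA => by
    have hA' := mem_safeRounds hh hA
    exact le_biSup (fun A => coalitionValue P i w j (nextView i (h.view {.buyer i}) R A)) hA'

theorem mean_aloneRun_succ (n j : ℕ) :
    ((aloneRun P i w (n + 1)).mean fun h => coalitionValue P i w j (h.view {.buyer i})) =
      (aloneRun P i w n).mean fun h => (buyerRound P i w (h.view {.buyer i})).mean fun R =>
        (aloneRound P i w h).mean fun A =>
          coalitionValue P i w j (nextView i (h.view {.buyer i}) R A) := by
  simp only [aloneRun, honestRun, run, PMF.mean_bind, PMF.mean_map,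
    step_honest P (Finset.mem_singleton_self i), facingStep]
  rfl

theorem mean_aloneRun_antitone {m n : ℕ} (hmn : m ≤ n) (hn : n ≤ P.rounds {i}) :
    ((aloneRun P i w n).mean fun h =>
      coalitionValue P i w (P.rounds {i} - n) (h.view {.buyer i})) ≤
    (aloneRun P i w m).mean fun h =>
      coalitionValue P i w (P.rounds {i} - m) (h.view {.buyer i}) := by
  induction n, hmn using Nat.le_induction with
  | base => exact le_rfl
  | succ n hmn ih =>
    refine le_trans ?_ (ih (by omega))
    rw [mean_aloneRun_succ]
    refine PMF.mean_mono fun h hh => ?_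
    obtain ⟨j, hj⟩ : ∃ j, P.rounds {i} - n = j + 1 := ⟨P.rounds {i} - n - 1, by omega⟩
    have hj' : P.rounds {i} - (n + 1) = j := by omega
    rw [hj, hj', coalitionValue]
    exact PMF.mean_mono fun R _ => mean_aloneRound_le hh R j

theorem revenue_le_mean :
    revenue P i w ≤ (aloneRun P i w (P.rounds {i})).mean fun h =>
      coalitionValue P i w 0 (h.view {.buyer i}) := by
  rw [revenue, mean_honest_pay]
  exact PMF.mean_mono fun h hh => PMF.mean_le fun n hn =>
    le_biSup (fun n : Notice Id => (n.pay i : ℝ≥0∞)) ⟨h, hh, rfl, hn⟩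

theorem revenue_le {k : ℕ} {U : Set ℝ≥0} (hP : IsAuction k U P) (hw : w ∈ U) : revenue P i w ≤ w :=
  PMF.mean_le fun tr htr => by
    exact_mod_cast honest_pay_le hP (v := fun _ => w) (fun _ _ => hw) htr
      (Finset.mem_singleton_self i)

section Revenue

variable {k : ℕ} {U : Set ℝ≥0} (hP : IsAuction k U P) (hpsIC : ExPostPSIC k U P) (hw : w ∈ U)

include hP hpsIC hw

theorem coalitionValue_le_revenue : coalitionValue P i w (P.rounds {i}) [] ≤ revenue P i w := by
  refine le_of_forall_pow_mul_le (n := P.rounds {i} + 1) fun c hc => ?_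
  refine le_trans ?_ (mean_pay_le_revenue hP hpsIC hw (S := nearOptimal P i w k c)
    nearOptimal_feasible fun h hh n hn a ha => ?_)
  · rw [pow_succ', mul_assoc]
    refine (mul_le_mul_right (pow_mul_le_mean_nearOptimal hP hw hc le_rfl) c).trans ?_
    rw [← PMF.mean_const_mul]
    refine PMF.mean_mono fun h hh => ?_
    obtain ⟨g, hg, hgh⟩ := nearOptimal_run hP hw hc hh
    obtain ⟨n, -, hout, hle⟩ := nearOptimal_outcome (k := k) hP hw hc hg hgh
    rw [hout, PMF.mean_pure, Nat.sub_self]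
    exact hle
  · obtain ⟨g, hg, hgh⟩ := nearOptimal_run hP hw hc hh
    obtain ⟨n', hn', hout, -⟩ := nearOptimal_outcome (k := k) hP hw hc hg hgh
    rw [hout, PMF.mem_support_pure_iff] at hn
    subst hn
    exact accept_of_credible hP (fun _ _ => hw) (Finset.mem_singleton_self i) hn' ha

/-- At every time, the expected value of an optimal coalition is the honest revenue. -/
theorem mean_coalitionValue {m : ℕ} (hm : m ≤ P.rounds {i}) :
    ((aloneRun P i w m).mean fun h =>
      coalitionValue P i w (P.rounds {i} - m) (h.view {.buyer i})) = revenue P i w := by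
  refine le_antisymm ?_ ?_
  · refine (mean_aloneRun_antitone (Nat.zero_le m) hm).trans
      (le_of_eq_of_le ?_ (coalitionValue_le_revenue hP hpsIC hw))
    simp [aloneRun, honestRun, run, PMF.mean_pure, History.view]
  · refine revenue_le_mean.trans ?_
    simpa only [Nat.sub_self] using mean_aloneRun_antitone (P := P) (i := i) (w := w) hm le_rfl

theorem coalitionValue_nextView {m j : ℕ} (hm : m + (j + 1) = P.rounds {i}) {h : History Id Msg}
    (hh : h ∈ (aloneRun P i w m).support) {R : Round Id Msg}
    (hR : R ∈ (buyerRound P i w (h.view {.buyer i})).support) {A : Round Id Msg}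
    (hA : A ∈ (aloneRound P i w h).support) :
    coalitionValue P i w j (nextView i (h.view {.buyer i}) R A) =
      ⨆ A ∈ safeRounds P i w (h.view {.buyer i}),
        coalitionValue P i w j (nextView i (h.view {.buyer i}) R A) := by
  have h0 := mean_coalitionValue (i := i) hP hpsIC hw (m := m) (by omega)
  have h1 := mean_coalitionValue (i := i) hP hpsIC hw (m := m + 1) (by omega)
  rw [show P.rounds {i} - m = j + 1 by omega] at h0
  rw [show P.rounds {i} - (m + 1) = j by omega, mean_aloneRun_succ] at h1
  simp only [coalitionValue] at h0
  have hfin : ∀ x ≤ (w : ℝ≥0∞), x ≠ ∞ := fun x hx => ne_top_of_le_ne_top ENNReal.coe_ne_top hx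
  have e1 := PMF.eq_of_mean_le
    (fun h hh => PMF.mean_mono fun R _ => mean_aloneRound_le hh R j)
    (h0.trans h1.symm).le (hfin _ (h1.trans_le (revenue_le hP hw))) h hh
  have e2 := PMF.eq_of_mean_le (fun R _ => mean_aloneRound_le hh R j) e1.ge
    (hfin _ (PMF.mean_le fun R _ => PMF.mean_le fun A _ => coalitionValue_le hP hw _ _)) R hR
  exact PMF.eq_of_mean_le (g := fun _ => _)
    (fun A hA => le_biSup (fun A => coalitionValue P i w j
      (nextView i (h.view {.buyer i}) R A)) (mem_safeRounds hh hA))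
    ((PMF.mean_const _ _).trans_le e2.ge)
    (hfin _ (PMF.mean_le fun A _ => coalitionValue_le hP hw _ _)) A hA

theorem pay_eq_coalitionValue {h : History Id Msg}
    (hh : h ∈ (aloneRun P i w (P.rounds {i})).support) {n : Notice Id}
    (hn : n ∈ (honestNotice P {i} (fun _ => w) h).support) :
    (n.pay i : ℝ≥0∞) = coalitionValue P i w 0 (h.view {.buyer i}) := by
  have h0 := mean_coalitionValue (i := i) hP hpsIC hw le_rfl
  rw [Nat.sub_self] at h0
  have h1 : (aloneRun P i w (P.rounds {i})).mean (fun h =>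
      (honestNotice P {i} (fun _ => w) h).mean fun n => (n.pay i : ℝ≥0∞)) = revenue P i w :=
    (mean_honest_pay P {i} (fun _ => w) i).symm
  have hle : ∀ h ∈ (aloneRun P i w (P.rounds {i})).support,
      ∀ n ∈ (honestNotice P {i} (fun _ => w) h).support,
      (n.pay i : ℝ≥0∞) ≤ coalitionValue P i w 0 (h.view {.buyer i}) := fun h hh n hn =>
    le_biSup (fun n : Notice Id => (n.pay i : ℝ≥0∞)) ⟨h, hh, rfl, hn⟩
  have hfin : ∀ x ≤ (w : ℝ≥0∞), x ≠ ∞ := fun x hx => ne_top_of_le_ne_top ENNReal.coe_ne_top hx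
  have e1 := PMF.eq_of_mean_le (fun h hh => PMF.mean_le (hle h hh)) (h0.trans h1.symm).le
    (hfin _ (h1.trans_le (revenue_le hP hw))) h hh
  refine PMF.eq_of_mean_le (g := fun _ => _) (hle h hh) ((PMF.mean_const _ _).trans_le e1.ge) ?_ n hn
  exact hfin _ (e1.trans_le (coalitionValue_le hP hw _ _))

end Revenue

end Value

/-! ### A strategic buyer that makes sure to buy -/

section Imitation

variable (P : Protocol Id Msg) (i : Id) (w : ℝ≥0)

/-- The best payment that remains in `m` further rounds after the buyer with view `y` sends `R`. -/
noncomputable def moveValue (m : ℕ) (y : History Id Msg) (R : Round Id Msg) : ℝ≥0∞ :=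
  ⨆ A ∈ safeRounds P i w y, coalitionValue P i w m (nextView i y R A)

open Classical in
/-- Imitate the buyer `i` of value `w`, choosing only messages after which the value of the
coalition is positive. -/
noncomputable def imitation : Strategy Id Msg where
  joins := {i}
  act h _ :=
    if hR : ∃ R ∈ (buyerRound P i w (h.view {.buyer i})).support,
      0 < moveValue P i w (P.rounds {i} - h.length - 1) (h.view {.buyer i}) R
    then PMF.pure hR.choose else PMF.pure ⟨fun _ => none, fun _ => none, fun _ => none⟩
  rounds := 0
  outcome _ := PMF.pure ⟨fun _ => none, none⟩

variable {P i w}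

theorem participants_of_joins {S : Strategy Id Msg} (hS : S.joins = {i}) (v : Id → ℝ≥0) :
    participants (honestWorld ∅ v) S = {i} := by
  simp [participants, hS]

theorem merge_soloRound {S : Strategy Id Msg} (hS : S.joins = {i}) (v : Id → ℝ≥0)
    {h : History Id Msg} {R₀ : Round Id Msg}
    (hR₀ : R₀ ∈ (honestRound P (honestWorld ∅ v) S h).support) :
    ∃ A ∈ (aloneRound P i w h).support, ∀ b : Move Msg,
      merge (honestWorld ∅ v).strategic R₀ (soloRound i b) =
        merge (others i) (soloRound i b) A := by
  rw [honestRound_eq] at hR₀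
  simp only [PMF.mem_support_bind_iff, PMF.mem_support_map_iff, if_true,
    participants_of_joins hS] at hR₀
  obtain ⟨b₀, -, s, hs, m, hm, rfl⟩ := hR₀
  obtain ⟨b', hb'⟩ := (indepPMF fun j : ({i} : Finset Id) =>
    P.buyer j w (h.view {Party.buyer j.1})).support_nonempty
  refine ⟨assemble {i} b' s m, ?_, fun b => ?_⟩
  · rw [aloneRound, honestRound_eq]
    simp only [PMF.mem_support_bind_iff, PMF.mem_support_map_iff, if_true, participants_idle]
    exact ⟨b', hb', s, hs, m, hm, rfl⟩
  · simp only [merge, Round.mk.injEq]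
    refine ⟨?_, ?_, ?_⟩ <;> funext q <;> cases q <;> simp [assemble, soloRound]
    all_goals
      rename_i j
      by_cases hj : j = i <;> simp [hj]

theorem imitation_act {v : Id → ℝ≥0} {h : History Id Msg} {j : ℕ}
    (hj : P.rounds {i} = h.length + (j + 1))
    (hpos : 0 < coalitionValue P i w (j + 1) (h.view {.buyer i})) (R₀ : Round Id Msg) :
    ∃ R ∈ (buyerRound P i w (h.view {.buyer i})).support,
      (imitation P i w).act (h.view (honestWorld ∅ v).strategic) R₀ = PMF.pure R ∧
        0 < moveValue P i w j (h.view {.buyer i}) R := by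
  have hview : (h.view (honestWorld ∅ v).strategic).view {.buyer i} = h.view {.buyer i} :=
    history_view_view (by simp) h
  have hlen : P.rounds {i} - (h.view (honestWorld ∅ v).strategic).length - 1 = j := by
    rw [length_view]; omega
  have hex : ∃ R ∈ (buyerRound P i w (h.view {.buyer i})).support,
      0 < moveValue P i w j (h.view {.buyer i}) R := by
    by_contra! hcon
    exact hpos.not_ge (PMF.mean_le hcon)
  rw [← hview, ← hlen] at hex
  have hspec := hex.choose_spec
  have hact : (imitation P i w).act (h.view (honestWorld ∅ v).strategic) R₀ =
      PMF.pure hex.choose := dif_pos hex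
  generalize hex.choose = R at hspec hact
  rw [hview, hlen] at hspec
  exact ⟨R, hspec.1, hact, hspec.2⟩

variable {k : ℕ} {U : Set ℝ≥0} (hP : IsAuction k U P) (hpsIC : ExPostPSIC k U P) (hw : w ∈ U)
  (hrev : 0 < revenue P i w)

include hP hpsIC hw hrev

theorem imitation_run (v : Id → ℝ≥0) {m : ℕ} (hm : m ≤ P.rounds {i}) {h : History Id Msg}
    (hh : h ∈ (run P (honestWorld ∅ v) (imitation P i w) m).support) :
    h ∈ (aloneRun P i w m).support ∧
      0 < coalitionValue P i w (P.rounds {i} - m) (h.view {.buyer i}) := by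
  induction m generalizing h with
  | zero =>
    have : h = [] := List.length_eq_zero_iff.1 (length_of_mem_run _ _ _ hh)
    subst this
    refine ⟨by simp [run], ?_⟩
    have := mean_coalitionValue (i := i) hP hpsIC hw (Nat.zero_le _)
    simp only [aloneRun, honestRun, run, PMF.mean_pure] at this
    rwa [this]
  | succ m ih =>
    simp only [run, step, PMF.mem_support_bind_iff, PMF.mem_support_map_iff] at hh
    obtain ⟨h, hh, _, ⟨R₀, hR₀, R, hR, rfl⟩, rfl⟩ := hh
    obtain ⟨hal, hpos⟩ := ih (by omega) hh
    have hlen := length_of_mem_run _ _ _ hh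
    obtain ⟨j, hj⟩ : ∃ j, P.rounds {i} - m = j + 1 := ⟨P.rounds {i} - m - 1, by omega⟩
    rw [hj] at hpos
    obtain ⟨R', hR', hact, hmv⟩ := imitation_act (v := v) (by omega) hpos
      (R₀.view (honestWorld ∅ v).strategic)
    rw [hact, PMF.mem_support_pure_iff] at hR
    subst hR
    obtain ⟨A, hA, hmerge⟩ := merge_soloRound (w := w) (i := i) rfl v hR₀
    obtain ⟨b, -, rfl⟩ := (PMF.mem_support_map_iff _ _ _).1 hR'
    rw [hmerge, ← nextView_view, show P.rounds {i} - (m + 1) = j by omega,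
      coalitionValue_nextView hP hpsIC hw (by omega) hal hR' hA]
    exact ⟨mem_aloneRun_succ.2 ⟨h, hal, _, hR', A, hA, rfl⟩, hmv⟩

theorem imitation_util (v : Id → ℝ≥0) (w' : ℝ≥0) {tr : Trace Id}
    (htr : tr ∈ (exec P (honestWorld ∅ v) (imitation P i w)).support) :
    (w' : ℝ) - w ≤ buyerUtil {i} w' tr := by
  have hU : ∀ j ∈ ({i} : Finset Id), (fun _ : Id => w) j ∈ U := fun _ _ => hw
  obtain ⟨h, hh, hn, -⟩ := exists_of_mem_exec htr
  rw [numRounds, if_pos rfl, participants_of_joins rfl] at hh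
  obtain ⟨hal, hpos⟩ := imitation_run hP hpsIC hw hrev v le_rfl hh
  have hn' : tr.notice ∈ (honestNotice P {i} (fun _ => w) h).support := by
    rw [noticeLaw, if_pos rfl, participants_of_joins rfl] at hn
    rw [honestNotice, noticeLaw, if_pos rfl, participants_idle]
    exact hn
  rw [Nat.sub_self, ← pay_eq_coalitionValue hP hpsIC hw hal hn'] at hpos
  obtain ⟨tr', htr', heq⟩ := exists_trace_of_credible (i := i) ⟨h, hal, rfl, hn'⟩
  have hacc : tr.platformAccepts = true := by
    have := (hP.accept _ _ hU tr' htr').1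
    rwa [Trace.platformAccepts, heq] at this
  have hle : tr.pay i ≤ w := by
    have := honest_pay_le hP hU htr' (Finset.mem_singleton_self i)
    rwa [Trace.pay, heq] at this
  have hitems : 0 < tr.items i := by
    have h2 := (honest_rational hP hU htr' (Finset.mem_singleton_self i)).2
    rw [Trace.pay, Trace.items, heq] at h2
    refine Nat.pos_of_ne_zero fun h0 => ?_
    rw [Trace.items] at h0
    rw [h0, Nat.cast_zero, zero_mul] at h2
    have h3 : tr.notice.pay i = 0 := le_antisymm h2 zero_le
    simp [h3] at hpos
  have hle' : (tr.pay i : ℝ) ≤ w := by exact_mod_cast hle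
  simp only [buyerUtil, hacc, if_true, Finset.mem_singleton, exists_eq_left, hitems,
    Finset.sum_singleton]
  linarith

end Imitation

section Main

variable {k : ℕ} {U : Set ℝ≥0} {P : Protocol Id Msg}

theorem honest_buyerUtil (hP : IsAuction k U P) {j : Id} {w : ℝ≥0} (hw : w ∈ U) {tr : Trace Id}
    (htr : tr ∈ (honestExec P {j} fun _ => w).support) :
    0 ≤ buyerUtil {j} w tr ∧ buyerUtil {j} w tr + tr.pay j ≤ w := by
  have hU : ∀ i ∈ ({j} : Finset Id), (fun _ : Id => w) i ∈ U := fun _ _ => hw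
  have hj := Finset.mem_singleton_self j
  have hacc := (hP.accept _ _ hU tr htr).1
  have hle : (tr.pay j : ℝ) ≤ w := by exact_mod_cast honest_pay_le hP hU htr hj
  simp only [buyerUtil, hacc, if_true, Finset.mem_singleton, exists_eq_left, Finset.sum_singleton]
  by_cases hitems : 0 < tr.items j
  · simp only [hitems, if_true]
    exact ⟨by linarith, by linarith⟩
  · have h2 := (honest_rational hP hU htr hj).2
    rw [Nat.eq_zero_of_not_pos hitems, Nat.cast_zero, zero_mul] at h2
    have h3 : tr.pay j = 0 := le_antisymm h2 zero_le
    simp [hitems, h3]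

/-- A lone buyer pays at most any value at which some lone buyer pays something. -/
theorem revenue_le_of_revenue_pos {D : MeasureTheory.Measure ℝ≥0}
    [MeasureTheory.IsProbabilityMeasure D] (hP : IsAuction k U P) (hbIC : BayesianBIC U D P)
    (hpsIC : ExPostPSIC k U P) {i j : Id} {w w' : ℝ≥0} (hw : w ∈ U) (hw' : w' ∈ U)
    (hrev : 0 < revenue P i w) : revenue P j w' ≤ w := by
  classical
  rcases le_total w' w with hle | hle
  · exact (revenue_le hP hw').trans (by exact_mod_cast hle)
  have h := hbIC ∅ j (Finset.notMem_empty j) w' hw' (imitation P i w)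
  rw [expectOver_of_unique, expectOver_of_unique, Finset.sdiff_empty,
    honestExec_congr P (H := insert j ∅) (v' := fun _ => w') (by simp), insert_empty_eq] at h
  have hutil := fun tr htr => imitation_util hP hpsIC hw hrev (extend ∅ default) w' (tr := tr) htr
  have hwr : (w : ℝ) ≤ w' := by exact_mod_cast hle
  change expect (exec P (honestWorld ∅ (extend ∅ default)) (imitation P i w))
    (buyerUtil {i} w') ≤ _ at h
  rw [expect_of_nonneg fun tr htr => (sub_nonneg.2 hwr).trans (hutil tr htr),
    expect_of_nonneg fun tr htr => (honest_buyerUtil hP hw' htr).1,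
    EReal.coe_ennreal_le_coe_ennreal_iff, posExp_eq_mean, posExp_eq_mean] at h
  have h1 : ENNReal.ofReal (w' - w) ≤ (honestExec P {j} fun _ => w').mean fun tr =>
      ENNReal.ofReal (buyerUtil {j} w' tr) :=
    (PMF.le_mean fun tr htr => ENNReal.ofReal_le_ofReal (hutil tr htr)).trans h
  have h2 : ((honestExec P {j} fun _ => w').mean fun tr =>
      ENNReal.ofReal (buyerUtil {j} w' tr)) + revenue P j w' ≤ w' := by
    rw [revenue, ← PMF.mean_add]
    refine PMF.mean_le fun tr htr => ?_
    obtain ⟨h0, h1⟩ := honest_buyerUtil hP hw' htr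
    rw [← ENNReal.ofReal_coe_nnreal, ← ENNReal.ofReal_coe_nnreal,
      ← ENNReal.ofReal_add h0 (NNReal.coe_nonneg _)]
    exact ENNReal.ofReal_le_ofReal h1
  have h3 : ENNReal.ofReal (w' - w) + revenue P j w' ≤ ENNReal.ofReal (w' - w) + w := by
    refine (add_le_add_left h1 _).trans (h2.trans_eq ?_)
    rw [← ENNReal.ofReal_coe_nnreal (p := w), ← ENNReal.ofReal_add (by linarith) (by positivity),
      sub_add_cancel, ENNReal.ofReal_coe_nnreal]
  exact (ENNReal.add_le_add_iff_left ENNReal.ofReal_ne_top).1 h3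

theorem expectedRevenue_eq (P : Protocol Id Msg) (H : Finset Id) (v : Id → ℝ≥0) :
    expectedRevenue P H v =
      ((∑ i ∈ H, (honestExec P H v).mean fun tr => (tr.pay i : ℝ≥0∞) : ℝ≥0∞) : EReal) := by
  rw [expectedRevenue, expect_of_nonneg fun tr _ => Finset.sum_nonneg fun _ _ => NNReal.coe_nonneg _,
    posExp_eq_mean, ← PMF.mean_sum]
  congr 1
  refine PMF.mean_congr fun tr _ => ?_
  rw [ENNReal.ofReal_sum_of_nonneg fun _ _ => NNReal.coe_nonneg _]
  exact Finset.sum_congr rfl fun i _ => ENNReal.ofReal_coe_nnreal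

end Main

end Auction

theorem mainTheorem7 {Id Msg : Type*} (k : ℕ) (U : Set ℝ≥0)
    (D : MeasureTheory.Measure ℝ≥0) [MeasureTheory.IsProbabilityMeasure D]
    (hD : ∀ᵐ x ∂D, x ∈ U)
    (P : Auction.Protocol Id Msg) (hP : Auction.IsAuction k U P)
    (hbIC : Auction.BayesianBIC U D P) (hpsIC : Auction.ExPostPSIC k U P) :
    Auction.RevenueDominatedByPostedPrice U P := by
  set s : Set ℝ≥0 := {w | w ∈ U ∧ ∃ i, 0 < Auction.revenue P i w} with hs
  refine ⟨sInf s, fun H v hv => ?_⟩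
  have hkey : ∀ i ∈ H, ((Auction.honestExec P H v).mean fun tr => (tr.pay i : ℝ≥0∞)) ≤
      ((if sInf s ≤ v i then sInf s else 0 : ℝ≥0) : ℝ≥0∞) := by
    intro i hi
    refine (Auction.mean_pay_le_alone hP hpsIC hv hi).trans ?_
    by_cases h0 : Auction.revenue P i (v i) = 0
    · simp [h0]
    have hmem : v i ∈ s := ⟨hv i hi, i, pos_iff_ne_zero.2 h0⟩
    rw [if_pos (csInf_le (OrderBot.bddBelow s) hmem)]
    have hfin : Auction.revenue P i (v i) ≠ ∞ :=
      ne_top_of_le_ne_top ENNReal.coe_ne_top (Auction.revenue_le hP (hv i hi))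
    lift Auction.revenue P i (v i) to ℝ≥0 using hfin with x hx
    rw [ENNReal.coe_le_coe]
    refine le_csInf ⟨_, hmem⟩ fun w hw => ?_
    obtain ⟨hwU, j, hj⟩ := hw
    have := Auction.revenue_le_of_revenue_pos hP hbIC hpsIC (j := i) hwU (hv i hi) hj
    rwa [← hx, ENNReal.coe_le_coe] at this
  rw [Auction.expectedRevenue_eq]
  have hsum : Auction.postedPriceRevenue (sInf s) H v =
      ((∑ i ∈ H, if sInf s ≤ v i then sInf s else 0 : ℝ≥0) : ℝ) := by
    rw [Auction.postedPriceRevenue, NNReal.coe_sum]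
    exact Finset.sum_congr rfl fun i _ => by split_ifs <;> rfl
  have hle := Finset.sum_le_sum hkey
  rw [← ENNReal.ofNNReal_finsetSum] at hle
  rw [hsum]
  exact EReal.coe_ennreal_le_coe_ennreal_iff.2 hle
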